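/- **Theorem (Compactness of ${\sf QBD2}$).** Let ${\bf 4}=\{1,{\bf b},{\bf n},0\}$ be the four-element lattice with bottom $0$, top $1$ and incomparable ${\bf b},{\bf n}$, and let $\wedge,\vee$ be its meet and join. Define $\neg 1=0$, $\neg{\bf b}={\bf b}$, $\neg{\bf n}={\bf n}$, $\neg 0=1$; $\circ 1=1$, $\circ{\bf b}=0$, $\circ{\bf n}={\bf b}$, $\circ 0=1$ (where $\circ$ denotes the weak consistency operator); and $1\to y={\bf b}\to y=y$, $0\to y=1$, ${\bf n}\to 1={\bf n}\to{\bf n}=1$, ${\bf n}\to{\bf b}={\bf n}\to 0={\bf b}$. The designated values are $1$ and ${\bf b}$. Let $\mathcal S$ be a first-order signature consisting of arbitrary sets of predicate symbols, function symbols (each with a finite arity) and constant symbols, and let ${\rm For}(\mathcal S)$ be the set of first-order formulas (without built-in equality), possibly with free variables, built from a denumerable set $\mathcal V$ of variables with $\wedge,\vee,\to,\neg,\circ,\forall,\exists$. A ${\sf QBD2}$-structure $\mathfrak A$ has a non-empty domain $A$, and interprets each $n$-ary predicate symbol as a map $A^n\to{\bf 4}$, each $n$-ary function symbol as a map $A^n\to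 A$ and each constant symbol as an element of $A$. For an assignment $s:\mathcal V\to A$, the value $\|\varphi\|^{\mathfrak A}(s)\in{\bf 4}$ is defined recursively: an atomic formula $P(t_1,\dots,t_n)$ has the value $P^{\mathfrak A}(t_1^{\mathfrak A}[s],\dots,t_n^{\mathfrak A}[s])$, the connectives are interpreted by the operations above, $\|\forall x\,\varphi\|^{\mathfrak A}(s)=\inf_{a\in A}\|\varphi\|^{\mathfrak A}(s_x^a)$ and $\|\exists x\,\varphi\|^{\mathfrak A}(s)=\sup_{a\in A}\|\varphi\|^{\mathfrak A}(s_x^a)$, where $s_x^a$ agrees with $s$ except that it sends $x$ to $a$. The structure $\mathfrak A$ is a model of $\varphi$ if $\|\varphi\|^{\mathfrak A}(s)\in\{1,{\bf b}\}$ for every assignment $s$, and a model of a set of formulas if it is a model of each of its members. Write $\Delta\models_{\sf QBD2}\varphi$ if every model of $\Delta$ is a model of $\varphi$. Let $\Delta\cup\{\varphi\}\subseteq{\rm For}(\mathcal S)$. If $\Delta\models_{\sf QBD2}\varphi$, then there is a finite set $\Delta_0\subseteq\Delta$ such that $\Delta_0\models_{\sf QBD2}\varphi$. -/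

import Mathlib

universe u w

namespace QBD2

/-- The four truth values `1`, `b` (both), `n` (neither), `0`. -/
inductive Four : Type
  | one
  | b
  | n
  | zero
  deriving DecidableEq

namespace Four

instance : Fintype Four where
  elems := {one, b, n, zero}
  complete x := by cases x <;> decide

/-- Conjunction table of the four-element De Morgan algebra `DM4`. -/
def and : Four → Four → Four
  | one, y => y
  | x, one => x
  | b, b => b
  | n, n => n
  | _, _ => zero

/-- Disjunction table of `DM4`. -/
def or : Four → Four → Four
  | zero, y => y
  | x, zero => x
  | b, b => b
  | n, n => n
  | _, _ => one

/-- De Morgan negation. -/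
def neg : Four → Four
  | one => zero
  | b => b
  | n => n
  | zero => one

/-- Implication table of `BD2`. -/
def imp : Four → Four → Four
  | one, y => y
  | b, y => y
  | n, one => one
  | n, b => b
  | n, n => one
  | n, zero => b
  | zero, _ => one

/-- The weak consistency operator of `BD2`. -/
def cons : Four → Four
  | one => one
  | b => zero
  | n => b
  | zero => one

/-- The designated values `1` and `b`. -/
def designated : Set Four := {one, b}

instance : Min Four := ⟨Four.and⟩

instance : Max Four := ⟨Four.or⟩

/-- The lattice order of `DM4` (`x ≤ y` iff `x ∨ y = y`): `0` is the bottom, `1` is the top, and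
`b`, `n` are incomparable. -/
instance : Lattice Four :=
  Lattice.mk' (by decide) (by decide) (by decide) (by decide) (by decide) (by decide)

instance : BoundedOrder Four where
  top := one
  bot := zero
  le_top x := sup_eq_right.mp (by revert x; decide)
  bot_le x := sup_eq_right.mp (by revert x; decide)

/-- A finite lattice is complete; this supplies the infima and suprema used for the quantifiers. -/
noncomputable instance : CompleteLattice Four := Fintype.toCompleteLattice Four

end Four

/-- A first-order signature: predicate symbols and function symbols with arities, and constant
symbols. -/
structure Signature where
  Pred : Type u
  predArity : Pred → ℕ
  Func : Type u
  funcArity : Func → ℕ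
  Const : Type u

/-- Terms; the denumerable set of individual variables is `ℕ`. -/
inductive Term (S : Signature.{u}) : Type u
  | var (x : ℕ) : Term S
  | const (c : S.Const) : Term S
  | func (f : S.Func) (ts : Fin (S.funcArity f) → Term S) : Term S

/-- Formulas over the connectives `∧, ∨, →, ¬`, the consistency operator, and both quantifiers. -/
inductive Formula (S : Signature.{u}) : Type u
  | pred (P : S.Pred) (ts : Fin (S.predArity P) → Term S) : Formula S
  | neg (φ : Formula S) : Formula S
  | cons (φ : Formula S) : Formula S
  | and (φ ψ : Formula S) : Formula S
  | or (φ ψ : Formula S) : Formula S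
  | imp (φ ψ : Formula S) : Formula S
  | all (x : ℕ) (φ : Formula S) : Formula S
  | ex (x : ℕ) (φ : Formula S) : Formula S

/-- A `4`-structure: a non-empty domain, four-valued predicates, total functions, constants. -/
structure Structure (S : Signature.{u}) where
  Dom : Type w
  nonempty : Nonempty Dom
  pred : (P : S.Pred) → (Fin (S.predArity P) → Dom) → Four
  func : (f : S.Func) → (Fin (S.funcArity f) → Dom) → Dom
  const : S.Const → Dom

namespace Structure

/-- The value of a term under an assignment. -/
def termVal {S : Signature.{u}} (A : Structure.{u, w} S) (s : ℕ → A.Dom) : Term S → A.Dom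
  | .var x => s x
  | .const c => A.const c
  | .func f ts => A.func f (fun i => A.termVal s (ts i))

/-- The truth value of a formula under an assignment. -/
noncomputable def val {S : Signature.{u}} (A : Structure.{u, w} S) :
    Formula S → (ℕ → A.Dom) → Four
  | .pred P ts, s => A.pred P (fun i => A.termVal s (ts i))
  | .neg φ, s => (A.val φ s).neg
  | .cons φ, s => (A.val φ s).cons
  | .and φ ψ, s => (A.val φ s).and (A.val ψ s)
  | .or φ ψ, s => (A.val φ s).or (A.val ψ s)
  | .imp φ ψ, s => (A.val φ s).imp (A.val ψ s)
  | .all x φ, s => sInf {v | ∃ a : A.Dom, v = A.val φ (Function.update s x a)}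
  | .ex x φ, s => sSup {v | ∃ a : A.Dom, v = A.val φ (Function.update s x a)}

/-- The assignment `s` satisfies `φ` in `A`. -/
def Satisfies {S : Signature.{u}} (A : Structure.{u, w} S) (s : ℕ → A.Dom) (φ : Formula S) :
    Prop :=
  A.val φ s ∈ Four.designated

/-- `A` is a model of the formula `φ`: every assignment satisfies `φ`. -/
def IsModel {S : Signature.{u}} (A : Structure.{u, w} S) (φ : Formula S) : Prop :=
  ∀ s : ℕ → A.Dom, A.Satisfies s φ

end Structure

/-- Semantic consequence: every model of all formulas in `Δ` is a model of `φ`. The domains range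
over a universe that is at least as large as that of the signature. -/
def Entails {S : Signature.{u}} (Δ : Set (Formula S)) (φ : Formula S) : Prop :=
  ∀ A : Structure.{u, max u w} S, (∀ γ ∈ Δ, A.IsModel γ) → A.IsModel φ

end QBD2

/-!
The proof is by ultraproducts. Along an ultrafilter, a family with values in the finite set `4` is
eventually constant, and taking its limit commutes with every operation on `4`. It also commutes
with the quantifiers: suitable witnesses for the factors can be collected into one element of the
product. Hence the value of a formula in an ultraproduct is the limit of its values in the factors,
which is Łoś's theorem. If no finite subset of `Δ` entails `φ`, pick a countermodel for each finite
subset; the ultraproduct of these along an ultrafilter finer than `atTop` is a countermodel for `Δ`.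
-/

namespace QBD2

open Filter

universe v

section Ultralimit

variable {I α β γ : Type*} [Finite α] [Finite β] [Finite γ] (U : Ultrafilter I)

theorem exists_eventually_eq (f : I → α) : ∃ c, ∀ᶠ i in U, f i = c :=
  Ultrafilter.eventually_exists_iff.mp (Eventually.of_forall fun i => ⟨f i, rfl⟩)

/-- The limit of a family in a finite type along an ultrafilter: the value that the family takes
eventually. It evaluates formulas in ultraproducts. -/
noncomputable def ultralimit (f : I → α) : α :=
  (exists_eventually_eq U f).choose

theorem eventually_eq_ultralimit (f : I → α) : ∀ᶠ i in U, f i = ultralimit U f :=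
  (exists_eventually_eq U f).choose_spec

variable {U} in
theorem ultralimit_mem_iff {f : I → α} {D : Set α} :
    ultralimit U f ∈ D ↔ ∀ᶠ i in U, f i ∈ D := by
  rw [eventually_congr ((eventually_eq_ultralimit U f).mono fun i hi => by rw [hi]),
    eventually_const]

variable {U} in
theorem ultralimit_eq_iff {f : I → α} {c : α} : ultralimit U f = c ↔ ∀ᶠ i in U, f i = c :=
  ultralimit_mem_iff (D := {c})

theorem map_ultralimit (g : α → β) (f : I → α) :
    g (ultralimit U f) = ultralimit U fun i => g (f i) :=
  (ultralimit_eq_iff.mpr ((eventually_eq_ultralimit U f).mono fun _ => congrArg g)).symm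

theorem map₂_ultralimit (g : α → β → γ) (f₁ : I → α) (f₂ : I → β) :
    g (ultralimit U f₁) (ultralimit U f₂) = ultralimit U fun i => g (f₁ i) (f₂ i) := by
  refine (ultralimit_eq_iff.mpr ?_).symm
  filter_upwards [eventually_eq_ultralimit U f₁, eventually_eq_ultralimit U f₂] with i h₁ h₂
  rw [h₁, h₂]

variable {X : I → Type*} [∀ i, Nonempty (X i)] (F : ∀ i, X i → α)

theorem range_ultralimit :
    Set.range (fun a : ∀ i, X i => ultralimit U fun i => F i (a i)) =
      ultralimit U fun i => Set.range (F i) := by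
  ext c
  calc (∃ a : ∀ i, X i, ultralimit U (fun i => F i (a i)) = c)
      ↔ ∃ a : ∀ i, X i, ∀ᶠ i in U, F i (a i) = c := exists_congr fun _ => ultralimit_eq_iff
    _ ↔ ∀ᶠ i in U, c ∈ Set.range (F i) :=
      (Filter.skolem (P := fun i x => F i x = c)).symm
    _ ↔ c ∈ ultralimit U fun i => Set.range (F i) :=
      (ultralimit_mem_iff (f := fun i => Set.range (F i)) (D := {R | c ∈ R})).symm

theorem iInf_ultralimit [InfSet α] :
    ⨅ a : ∀ i, X i, ultralimit U (fun i => F i (a i)) = ultralimit U fun i => ⨅ x, F i x :=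
  (congrArg sInf (range_ultralimit U F)).trans (map_ultralimit U sInf _)

theorem iSup_ultralimit [SupSet α] :
    ⨆ a : ∀ i, X i, ultralimit U (fun i => F i (a i)) = ultralimit U fun i => ⨆ x, F i x :=
  (congrArg sSup (range_ultralimit U F)).trans (map_ultralimit U sSup _)

end Ultralimit

theorem eval_update {J I : Type*} [DecidableEq J] {X : I → Type*} (s : J → ∀ i, X i) (x : J)
    (a : ∀ i, X i) (i : I) : (Function.update s x a · i) = Function.update (s · i) x (a i) :=
  Function.comp_update (Function.eval i) s x a

namespace Structure

variable {S : Signature.{u}}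

attribute [instance] Structure.nonempty

theorem val_all (A : Structure.{u, w} S) (x : ℕ) (φ : Formula S) (s : ℕ → A.Dom) :
    A.val (.all x φ) s = ⨅ a, A.val φ (Function.update s x a) := by
  simp only [val, iInf, Set.range, eq_comm]

theorem val_ex (A : Structure.{u, w} S) (x : ℕ) (φ : Formula S) (s : ℕ → A.Dom) :
    A.val (.ex x φ) s = ⨆ a, A.val φ (Function.update s x a) := by
  simp only [val, iSup, Set.range, eq_comm]

variable {I : Type v} (U : Ultrafilter I) (A : I → Structure.{u, w} S)

/-- The ultraproduct of a family of structures. Since the language has no equality, the domain is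
the full product, without passing to the quotient by the ultrafilter. -/
noncomputable def ultraproduct : Structure.{u, max v w} S where
  Dom := ∀ i, (A i).Dom
  nonempty := inferInstance
  pred P a := ultralimit U fun i => (A i).pred P fun k => a k i
  func f a i := (A i).func f fun k => a k i
  const c i := (A i).const c

theorem termVal_ultraproduct (s : ℕ → ∀ i, (A i).Dom) (t : Term S) :
    (ultraproduct U A).termVal s t = fun i => (A i).termVal (s · i) t := by
  induction t with
  | var x => rfl
  | const c => rfl
  | func f ts ih =>
    simp only [termVal, ih]
    rfl

theorem val_ultraproduct (φ : Formula S) (s : ℕ → ∀ i, (A i).Dom) :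
    (ultraproduct U A).val φ s = ultralimit U fun i => (A i).val φ (s · i) := by
  induction φ generalizing s with
  | pred P ts =>
    simp only [val, termVal_ultraproduct]
    rfl
  | neg φ ih => simp only [val, ih, map_ultralimit U Four.neg]
  | cons φ ih => simp only [val, ih, map_ultralimit U Four.cons]
  | and φ ψ ihφ ihψ => simp only [val, ihφ, ihψ, map₂_ultralimit U Four.and]
  | or φ ψ ihφ ihψ => simp only [val, ihφ, ihψ, map₂_ultralimit U Four.or]
  | imp φ ψ ihφ ihψ => simp only [val, ihφ, ihψ, map₂_ultralimit U Four.imp]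
  | all x φ ih =>
    simp only [val_all, ← iInf_ultralimit, ← eval_update, ← ih]
    exact val_all (ultraproduct U A) x φ s
  | ex x φ ih =>
    simp only [val_ex, ← iSup_ultralimit, ← eval_update, ← ih]
    exact val_ex (ultraproduct U A) x φ s

theorem satisfies_ultraproduct_iff (φ : Formula S) (s : ℕ → ∀ i, (A i).Dom) :
    (ultraproduct U A).Satisfies s φ ↔ ∀ᶠ i in U, (A i).Satisfies (s · i) φ := by
  simp only [Satisfies, val_ultraproduct, ultralimit_mem_iff]

theorem isModel_ultraproduct_iff (φ : Formula S) :
    (ultraproduct U A).IsModel φ ↔ ∀ᶠ i in U, (A i).IsModel φ := by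
  constructor
  · intro hφ
    by_contra hU
    have hrefuted : ∀ᶠ i in U, ∃ s, ¬ (A i).Satisfies s φ :=
      (Ultrafilter.eventually_not.mpr hU).mono fun _ => not_forall.mp
    obtain ⟨s, hs⟩ := Filter.skolem.mp hrefuted
    have hsat := (satisfies_ultraproduct_iff U A φ fun x i => s i x).mp (hφ _)
    exact Ultrafilter.eventually_not.mp hs hsat
  · intro hφ s
    exact (satisfies_ultraproduct_iff U A φ s).mpr (hφ.mono fun i hi => hi (s · i))

end Structure

end QBD2

theorem mainTheorem5 (S : QBD2.Signature.{u}) (Δ : Set (QBD2.Formula S)) (φ : QBD2.Formula S)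
    (h : QBD2.Entails.{u, w} Δ φ) :
    ∃ Δ₀ : Set (QBD2.Formula S), Δ₀.Finite ∧ Δ₀ ⊆ Δ ∧ QBD2.Entails.{u, w} Δ₀ φ := by
  by_contra! hfin
  have hcounter (F : Finset Δ) : ∃ A : QBD2.Structure.{u, max u w} S,
      (∀ γ ∈ F, A.IsModel γ) ∧ ¬ A.IsModel φ := by
    simpa [QBD2.Entails] using hfin (Subtype.val '' (F : Set Δ)) (F.finite_toSet.image _) (by simp)
  choose A hA hAφ using hcounter
  let U : Ultrafilter (Finset Δ) := .of Filter.atTop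
  have hΔ : ∀ γ ∈ Δ, (QBD2.Structure.ultraproduct U A).IsModel γ := fun γ hγ => by
    have hmem : ∀ᶠ F : Finset Δ in U, ⟨γ, hγ⟩ ∈ F :=
      Ultrafilter.of_le Filter.atTop (Filter.eventually_finset_mem_atTop _)
    exact (QBD2.Structure.isModel_ultraproduct_iff U A γ).mpr (hmem.mono fun F => hA F ⟨γ, hγ⟩)
  have hφ : ∀ᶠ F in U, (A F).IsModel φ :=
    (QBD2.Structure.isModel_ultraproduct_iff U A φ).mp (h _ hΔ)
  obtain ⟨F, hF⟩ := hφ.exists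
  exact hAφ F hF
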